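/- Let $n\ge 1$ and let $s=\langle s_1,\dots,s_{n-1}\rangle$ be a sequence of transpositions of $[n]=\{1,\dots,n\}$ whose left-to-right product ($s_1$ acts first) is the cycle $(n,\dots,2,1)$, i.e. $k\mapsto k-1$ for $k\ge 2$ and $1\mapsto n$; the set of these sequences is $F_{\downarrow}(n)$. View $s$ as the labeled graph (a tree) on the vertex set $[n]$ with one edge $\{x,y\}$, labeled $k$, for each $s_k=(x,y)$. Duals. For $x\in[n]$ let $T_x$ be the minimal increasing greedy trail (MIGT) starting at $x$: from the current vertex it always takes the incident edge with the smallest label larger than all labels used so far, and it stops when there is none. The trail dual of $s$ is the labeled graph on $[n]$ with an edge labeled $k$ between distinct $x,y$ exactly when both $T_x$ and $T_y$ use the edge labeled $k$. The mind-body dual of $s$ is the transposition sequence $\langle s_1',\dots,s_{n-1}'\rangle$ in which, for $s_k=(x,y)$ and $A=s_1\cdots s_{k-1}$ (left-to-right product), $s_k'=(A^{-1}(x),A^{-1}(y))$. Circle chord diagram. Place $n$ distinct points on a circle in the plane, labeled $1,\dots,n$ in clockwise order, and for each $s_k=(x,y)$ draw the chord from $x$ to $y$, labeled $k$. Arc $k$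 is the open arc of the circle running clockwise from point $k-1$ to point $k$ (from point $n$ to point $1$ if $k=1$). The regions are the connected components of the closed disk with the chords removed. Theorem. For every $s\in F_{\downarrow}(n)$ and every such choice of circle and points: 1. Any two distinct chords meet, if at all, only at one of the $n$ labeled points. There are exactly $n$ regions, each arc lies in exactly one region and each region contains exactly one arc; call the region containing arc $k$ region $k$. 2. Define the Goulden–Yong dual of $s$ as the labeled graph whose vertices are the regions, the region $k$ being labeled $k$, with an edge labeled $k$ between two distinct regions exactly when chord $k$ lies on the boundary of both. Then the Goulden–Yong dual equals the dual of $s$: it is the same labeled graph on $[n]$ as the trail dual of $s$, and as the graph of the mind-body dual of $s$. 3. For all $x\in[n]$, the edges used by $T_x$ are exactly those whose chords lie on the boundary of region $x$. -/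

import Mathlib

/-- A transposition sequence of length `m` over the symmetric group on `Fin n`
(the element `i : Fin n` plays the role of `i + 1` in `{1, …, n}`, and similarly for the indices
of the entries). -/
structure TranspositionSeq (n m : ℕ) where
  perm : Fin m → Equiv.Perm (Fin n)
  isSwap : ∀ k, (perm k).IsSwap

/-- The edges of a finite loopless multigraph with vertex set `Fin n` and edge labels in `Fin m`:
`G k` is the set of edges that carry the label `k`. -/
abbrev LabeledGraph (n m : ℕ) := Fin m → Set (Sym2 (Fin n))

namespace TranspositionSeq

variable {n m : ℕ}

/-- The product `s₁ ⋯ s_j` of the first `j` entries, multiplied from left to right, that is, `s₁`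
acts first (Mathlib composes permutations from right to left, hence the reversal). It is also the
mind-body assignment `A_j`, which sends each mind to the body that it inhabits after the
first `j` swaps. -/
def partialProd (s : TranspositionSeq n m) (j : ℕ) : Equiv.Perm (Fin n) :=
  ((List.ofFn s.perm).take j).reverse.prod

/-- The product of the whole sequence, from left to right. -/
def prod (s : TranspositionSeq n m) : Equiv.Perm (Fin n) :=
  s.partialProd m

/-- The labeled graph of a transposition sequence: one edge `{x, y}` labeled `k` for the `k`-th
transposition `(x, y)`. -/
def graph (s : TranspositionSeq n m) : LabeledGraph n m :=
  fun k => {e | ∃ x, s.perm k x ≠ x ∧ e = s(x, s.perm k x)}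

/-- The greedy trail that stands at the vertex `v` and may only use labels `≥ b`: it takes the
smallest such edge incident to `v` (if there is one), say with label `e`, and continues from the
other end of that edge with labels `> e`. The list records the traversed labels, each with
the vertex reached. -/
def greedyTrail (s : TranspositionSeq n m) (b : ℕ) (v : Fin n) : List (Fin m × Fin n) :=
  if h : ∃ e : Fin m, b ≤ (e : ℕ) ∧ s.perm e v ≠ v then
    (Fin.find _ h, s.perm (Fin.find _ h) v) ::
      s.greedyTrail ((Fin.find _ h : ℕ) + 1) (s.perm (Fin.find _ h) v)
  else []
termination_by m - b
decreasing_by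
  have h1 := (Fin.find_spec h).1
  have h2 := (Fin.find _ h).isLt
  omega

/-- The minimal increasing greedy trail (MIGT) that starts at `u`, without its start vertex. -/
def migt (s : TranspositionSeq n m) (u : Fin n) : List (Fin m × Fin n) :=
  s.greedyTrail 0 u

/-- The MIGT that starts at `u` traverses the edge labeled `k`. -/
def MigtUses (s : TranspositionSeq n m) (u : Fin n) (k : Fin m) : Prop :=
  k ∈ (s.migt u).map Prod.fst

/-- The trail dual: an edge labeled `k` joins two distinct vertices `x`, `y` if the MIGTs starting
at `x` and at `y` both use the edge labeled `k`. -/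
def trailDual (s : TranspositionSeq n m) : LabeledGraph n m :=
  fun k => {e | ∃ x y, x ≠ y ∧ s.MigtUses x k ∧ s.MigtUses y k ∧ e = s(x, y)}

/-- The mind-body dual: if `s_k = (x, y)` and `A = A_{k-1}` is the mind-body assignment before the
`k`-th swap, its `k`-th entry is the transposition `(x', y')` of the minds `x' = A⁻¹ x` and
`y' = A⁻¹ y` that inhabit the bodies `x` and `y`. -/
def mindBodyDual (s : TranspositionSeq n m) : TranspositionSeq n m where
  perm k := (s.partialProd k)⁻¹ * s.perm k * s.partialProd k
  isSwap k := by
    obtain ⟨x, y, hxy, h⟩ := s.isSwap k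
    refine ⟨(s.partialProd k)⁻¹ x, (s.partialProd k)⁻¹ y, fun h' => hxy (by simpa using h'), ?_⟩
    have := Equiv.swap_apply_apply (s.partialProd k)⁻¹ x y
    rw [this, h, inv_inv]

end TranspositionSeq

/-- The transposition sequences of length `n - 1` over the symmetric group on `n` elements whose
product is the cycle `(n, …, 2, 1)`, which sends `k` to `k - 1` and `1` to `n`. -/
def FDown (n : ℕ) : Set (TranspositionSeq n (n - 1)) :=
  {s | s.prod = (finRotate n)⁻¹}

/-- A circle in the plane with `n` distinct points on it, labeled in clockwise order; `angle i` is
the clockwise angular position of the point with label `i`. -/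
structure CirclePoints (n : ℕ) where
  center : ℂ
  radius : ℝ
  radius_pos : 0 < radius
  angle : Fin n → ℝ
  angle_strictMono : StrictMono angle
  angle_lt : ∀ i j, angle j < angle i + 2 * Real.pi

namespace CirclePoints

variable {n m : ℕ}

/-- The point of the circle at clockwise angular position `φ`. -/
noncomputable def at_angle (C : CirclePoints n) (φ : ℝ) : ℂ :=
  C.center + C.radius * Complex.exp (-(φ * Complex.I))

/-- The point with label `i`. -/
noncomputable def point (C : CirclePoints n) (i : Fin n) : ℂ :=
  C.at_angle (C.angle i)

/-- The angular position of the point that precedes the point `k` on the circle, at most one turn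
before the point `k`. -/
noncomputable def prevAngle (C : CirclePoints n) (k : Fin n) : ℝ :=
  if (k : ℕ) = 0 then C.angle ((finRotate n).symm k) - 2 * Real.pi
  else C.angle ((finRotate n).symm k)

/-- Arc `k`: the open arc between the points `k - 1` and `k`
(between `n` and `1` for the first one). -/
noncomputable def arc (C : CirclePoints n) (k : Fin n) : Set ℂ :=
  C.at_angle '' Set.Ioo (C.prevAngle k) (C.angle k)

/-- The chord of the circle chord diagram that is labeled `k`, endpoints included. -/
noncomputable def chord (C : CirclePoints n) (s : TranspositionSeq n m) (k : Fin m) : Set ℂ :=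
  {p | ∃ x, s.perm k x ≠ x ∧ p ∈ segment ℝ (C.point x) (C.point (s.perm k x))}

/-- The disk without the chords. -/
noncomputable def chordComplement (C : CirclePoints n) (s : TranspositionSeq n m) : Set ℂ :=
  Metric.closedBall C.center C.radius \ ⋃ k, C.chord s k

/-- The regions into which the chords divide the disk: the connected components of the disk
without the chords. -/
noncomputable def regions (C : CirclePoints n) (s : TranspositionSeq n m) : Set (Set ℂ) :=
  {R | ∃ p ∈ C.chordComplement s, R = connectedComponentIn (C.chordComplement s) p}

/-- `R` is a region that contains arc `k`. -/
def IsRegionOf (C : CirclePoints n) (s : TranspositionSeq n m) (k : Fin n) (R : Set ℂ) : Prop :=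
  R ∈ C.regions s ∧ C.arc k ⊆ R

/-- Two distinct chords meet at most in a labeled point of the circle. -/
def NonCrossing (C : CirclePoints n) (s : TranspositionSeq n m) : Prop :=
  ∀ i j, i ≠ j → C.chord s i ∩ C.chord s j ⊆ Set.range C.point

/-- The Goulden–Yong dual: its vertices are the regions, the region that contains arc `u` being
labeled `u`, and there is an edge labeled `k` between two distinct regions if chord `k` lies on
the boundary of both. -/
def gouldenYongDual (C : CirclePoints n) (s : TranspositionSeq n m) : LabeledGraph n m :=
  fun k => {e | ∃ u v R S, C.IsRegionOf s u R ∧ C.IsRegionOf s v S ∧ R ≠ S ∧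
    C.chord s k ⊆ frontier R ∧ C.chord s k ⊆ frontier S ∧ e = s(u, v)}

end CirclePoints

/-! Think of each `u` as a mind that starts in the body `u` and is moved by the successive swaps.
The greedy trail from `u` is the itinerary of this mind: it uses the label `k` exactly when the
`k`-th swap moves mind `u`. Each swap moves exactly two minds, so the trail dual is the graph of the
mind-body dual (`trailDual_eq_mindBodyDual_graph`).

Since the product is a full cycle, the `n - 1` edges connect all vertices and form a tree, and
removing an edge `e` cuts the vertices into two sides (`IsCut`). Mind `u` travels from `u` to `u -
1` and can change sides only at swap `e`, so its trail uses `e` if and only if `u - 1` and `u` lie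
on different sides. Only two minds are moved by `e`, so around the circle the side changes only
twice (`IsCut.not_alternating`). Two crossing chords would have a separating edge between them in
the tree, whose cut alternates too often; hence chords do not cross.

In the disk, a chord is the zero set of an affine function, so the regions are the convex cells of
constant sign pattern. By noncrossing, adding a chord splits at most one cell, which gives at most
`n` regions (`card_sideVecs_le`). The `n` arcs have distinct sign patterns because the graph is
connected (`arc_eq_of_forall`), so arcs and regions correspond bijectively.

Chord `k` bounds region `u` if and only if arc `u` and the midpoint of the chord lie on the same
side of every other chord (`chord_subset_frontier_iff`). The cut of `k` shows this for the two
trails that use `k`; no third arc qualifies, since it would share all its signs with one of these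
two (`migtUses_iff_chord_subset_frontier`). -/

namespace TranspositionSeq

variable {n m : ℕ}

/-! ### Trails as itineraries of minds. -/

theorem partialProd_zero (s : TranspositionSeq n m) : s.partialProd 0 = 1 := by
  simp [partialProd]

theorem partialProd_succ (s : TranspositionSeq n m) (k : Fin m) :
    s.partialProd (k + 1) = s.perm k * s.partialProd k := by
  unfold partialProd
  rw [List.take_add_one]
  simp

theorem partialProd_eq_of_fixed (s : TranspositionSeq n m) (u : Fin n) {b e : ℕ} (hbe : b ≤ e)
    (hem : e ≤ m)
    (h : ∀ i : Fin m, b ≤ i → (i : ℕ) < e → s.perm i (s.partialProd b u) = s.partialProd b u) :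
    s.partialProd e u = s.partialProd b u := by
  induction e, hbe using Nat.le_induction with
  | base => rfl
  | succ e hbe ih =>
    have h1 := ih (by omega) fun i hi hie => h i hi (by omega)
    have h2 := s.partialProd_succ ⟨e, by omega⟩
    simp only at h2
    rw [h2, Equiv.Perm.mul_apply, h1]
    exact h ⟨e, by omega⟩ hbe (by simp)

/-- Started at the position of mind `u` after `b` swaps, the greedy trail is the rest of that mind's
itinerary: the smallest admissible label is the next swap that moves it. -/
theorem mem_greedyTrail_iff (s : TranspositionSeq n m) (u : Fin n) (k : Fin m) (b : ℕ) :
    k ∈ (s.greedyTrail b (s.partialProd b u)).map Prod.fst ↔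
      b ≤ k ∧ s.perm k (s.partialProd k u) ≠ s.partialProd k u := by
  induction hd : m - b using Nat.strong_induction_on generalizing b with
  | _ d ih =>
  rw [greedyTrail]
  split_ifs with h
  · obtain ⟨h1, h2⟩ := Fin.find_spec h
    have hmin : ∀ i : Fin m, i < Fin.find _ h → b ≤ i →
        s.perm i (s.partialProd b u) = s.partialProd b u := by
      intro i hi hb
      by_contra hc
      exact Fin.find_min h hi ⟨hb, hc⟩
    generalize Fin.find _ h = e at h1 h2 hmin
    have hfix : ∀ i : ℕ, b ≤ i → i ≤ e → s.partialProd i u = s.partialProd b u := by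
      intro i hbi hie
      refine s.partialProd_eq_of_fixed u hbi (by omega) fun j hj hji => hmin j ?_ hj
      rw [Fin.lt_def]; omega
    have hnext : s.perm e (s.partialProd b u) = s.partialProd (e + 1) u := by
      rw [s.partialProd_succ, Equiv.Perm.mul_apply, hfix e h1 le_rfl]
    have := ih (m - (e + 1)) (by omega) (e + 1) rfl
    rw [hnext, List.map_cons, List.mem_cons, this]
    constructor
    · rintro (rfl | ⟨h3, h4⟩)
      · exact ⟨h1, by rwa [hfix k h1 le_rfl]⟩
      · exact ⟨by omega, h4⟩
    · rintro ⟨h3, h4⟩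
      rcases lt_trichotomy k e with hlt | heq | hgt
      · refine absurd (hmin k hlt h3) ?_
        rwa [hfix k h3 (by rw [Fin.lt_def] at hlt; omega)] at h4
      · exact Or.inl heq
      · exact Or.inr ⟨hgt, h4⟩
  · simp only [List.map_nil, List.not_mem_nil, false_iff, not_and, not_not]
    intro hb
    push Not at h
    rw [s.partialProd_eq_of_fixed u hb (by omega) fun i hi _ => h i hi]
    exact h k hb

/-- The trail from `u` uses an edge exactly when the mind `u` takes part in the corresponding
swap. -/
theorem migtUses_iff (s : TranspositionSeq n m) (u : Fin n) (k : Fin m) :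
    s.MigtUses u k ↔ s.perm k (s.partialProd k u) ≠ s.partialProd k u := by
  have := s.mem_greedyTrail_iff u k 0
  simpa [MigtUses, migt, partialProd_zero] using this

theorem exists_swap_lt (s : TranspositionSeq n m) (k : Fin m) :
    ∃ e : Fin n × Fin n, e.1 < e.2 ∧ s.perm k = Equiv.swap e.1 e.2 := by
  obtain ⟨x, y, hxy, h⟩ := s.isSwap k
  rcases lt_or_gt_of_ne hxy with hlt | hgt
  · exact ⟨(x, y), hlt, h⟩
  · exact ⟨(y, x), hgt, by rw [h, Equiv.swap_comm]⟩

/-- The smaller endpoint of the edge labeled `k`. -/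
noncomputable def lo (s : TranspositionSeq n m) (k : Fin m) : Fin n :=
  (s.exists_swap_lt k).choose.1

/-- The larger endpoint of the edge labeled `k`. -/
noncomputable def hi (s : TranspositionSeq n m) (k : Fin m) : Fin n :=
  (s.exists_swap_lt k).choose.2

theorem lo_lt_hi (s : TranspositionSeq n m) (k : Fin m) : s.lo k < s.hi k :=
  (s.exists_swap_lt k).choose_spec.1

theorem perm_eq_swap (s : TranspositionSeq n m) (k : Fin m) :
    s.perm k = Equiv.swap (s.lo k) (s.hi k) :=
  (s.exists_swap_lt k).choose_spec.2

theorem perm_ne_iff (s : TranspositionSeq n m) (k : Fin m) (x : Fin n) :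
    s.perm k x ≠ x ↔ x = s.lo k ∨ x = s.hi k := by
  rw [s.perm_eq_swap, Equiv.swap_apply_ne_self_iff]
  simp [(s.lo_lt_hi k).ne]

theorem migtUses_iff_eq_or_eq (s : TranspositionSeq n m) (u : Fin n) (k : Fin m) :
    s.MigtUses u k ↔
      u = (s.partialProd k)⁻¹ (s.lo k) ∨ u = (s.partialProd k)⁻¹ (s.hi k) := by
  rw [migtUses_iff, perm_ne_iff, Equiv.Perm.eq_inv_iff_eq, Equiv.Perm.eq_inv_iff_eq]

theorem trailDual_eq_mindBodyDual_graph (s : TranspositionSeq n m) :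
    s.trailDual = s.mindBodyDual.graph := by
  funext k
  ext e
  simp only [trailDual, graph, mindBodyDual, Set.mem_ofPred_eq, Equiv.Perm.mul_apply]
  constructor
  · rintro ⟨x, y, hxy, hx, hy, rfl⟩
    refine ⟨x, ?_, ?_⟩
    · rw [migtUses_iff] at hx
      rwa [ne_eq, Equiv.Perm.inv_eq_iff_eq]
    · rw [migtUses_iff_eq_or_eq] at hx hy
      rw [s.perm_eq_swap]
      rcases hx with rfl | rfl <;> rcases hy with rfl | rfl <;> simp_all
  · rintro ⟨x, hx, rfl⟩
    refine ⟨x, _, hx.symm, ?_, ?_, rfl⟩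
    · rw [migtUses_iff]
      rwa [ne_eq, Equiv.Perm.inv_eq_iff_eq] at hx
    · rw [ne_eq, Equiv.Perm.inv_eq_iff_eq] at hx
      rw [migtUses_iff]
      simpa [eq_comm] using hx

/-! ### Cuts of the tree -/

theorem finRotate_symm_val (u : Fin n) :
    ((finRotate n).symm u : ℕ) = if (u : ℕ) = 0 then n - 1 else u - 1 := by
  obtain ⟨v, rfl⟩ := (finRotate n).surjective u
  rw [Equiv.symm_apply_apply]
  obtain _ | n := n
  · exact v.elim0
  by_cases hv : v = Fin.last n
  · subst hv; simp
  · rw [coe_finRotate_of_ne_last hv]; simp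

theorem comp_partialProd {α : Type*} (s : TranspositionSeq n m) (f : Fin n → α)
    (u : Fin n) (j : ℕ) (hj : j ≤ m)
    (hf : ∀ k : Fin m, (k : ℕ) < j →
      f (s.perm k (s.partialProd k u)) = f (s.partialProd k u)) :
    f (s.partialProd j u) = f u := by
  induction j with
  | zero => simp [partialProd_zero]
  | succ j ih =>
    have h2 := s.partialProd_succ ⟨j, by omega⟩
    simp only at h2
    rw [h2, Equiv.Perm.mul_apply]
    have := hf ⟨j, by omega⟩ (by simp)
    simp only at this
    rw [this, ih (by omega) fun k hk => hf k (by omega)]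

theorem partialProd_of_mem_FDown {s : TranspositionSeq n (n - 1)} (hs : s ∈ FDown n)
    (u : Fin n) : s.partialProd (n - 1) u = (finRotate n).symm u := by
  have : s.prod = (finRotate n)⁻¹ := hs
  rw [prod] at this
  rw [this]; rfl

/-- Connectedness of the graph: an invariant of all swaps is an invariant of their product, and the
product is transitive. -/
theorem eq_of_invariant {α : Type*} {s : TranspositionSeq n (n - 1)} (hs : s ∈ FDown n)
    (f : Fin n → α) (hf : ∀ k x, f (s.perm k x) = f x) (u v : Fin n) : f u = f v := by
  have hpred : ∀ u, f ((finRotate n).symm u) = f u := by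
    intro u
    rw [← partialProd_of_mem_FDown hs]
    exact s.comp_partialProd f u _ le_rfl fun k _ => hf k _
  have hn : 0 < n := u.pos
  have h0 : ∀ i : ℕ, ∀ hi : i < n, f ⟨i, hi⟩ = f ⟨0, hn⟩ := by
    intro i
    induction i with
    | zero => intro _; rfl
    | succ i ih =>
      intro hi
      rw [← ih (by omega), ← hpred ⟨i + 1, hi⟩]
      congr 1
      ext
      rw [finRotate_symm_val]; simp
  rw [h0 u u.2, h0 v v.2]

/-- The edge labeled `k`, as a vector over the field with two elements. -/
noncomputable def edgeVec (s : TranspositionSeq n m) (k : Fin m) : Fin n → ZMod 2 :=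
  Pi.single (s.lo k) 1 + Pi.single (s.hi k) 1

/-- The edge vectors, together with one unit vector. -/
noncomputable def rootedEdgeVec (s : TranspositionSeq n m) (r : Fin n) :
    Option (Fin m) → Fin n → ZMod 2
  | none => Pi.single r 1
  | some k => s.edgeVec k

/-- Along an edge, one end's unit vector lies in the span if and only if the other's does;
connectedness spreads membership from the root to all vertices. -/
theorem top_le_span_rootedEdgeVec {s : TranspositionSeq n (n - 1)} (hs : s ∈ FDown n)
    (r : Fin n) : ⊤ ≤ Submodule.span (ZMod 2) (Set.range (s.rootedEdgeVec r)) := by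
  set W := Submodule.span (ZMod 2) (Set.range (s.rootedEdgeVec r)) with hW
  have hedge : ∀ k, s.edgeVec k ∈ W := fun k => Submodule.subset_span ⟨some k, rfl⟩
  have hiff : ∀ k, (Pi.single (s.lo k) 1 : Fin n → ZMod 2) ∈ W ↔
      (Pi.single (s.hi k) 1 : Fin n → ZMod 2) ∈ W := by
    intro k
    constructor
    · intro h; exact (W.add_mem_iff_right h).1 (hedge k)
    · intro h; exact (W.add_mem_iff_left h).1 (hedge k)
  have hall : ∀ x, (Pi.single x 1 : Fin n → ZMod 2) ∈ W := by
    intro x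
    have := eq_of_invariant hs (fun x => (Pi.single x 1 : Fin n → ZMod 2) ∈ W) ?_ x r
    · simp only [eq_iff_iff] at this
      exact this.2 (Submodule.subset_span ⟨none, rfl⟩)
    · intro k x
      simp only [eq_iff_iff]
      by_cases hx : s.perm k x = x
      · rw [hx]
      · rcases (s.perm_ne_iff k x).1 hx with rfl | rfl
        · rw [s.perm_eq_swap, Equiv.swap_apply_left]; exact (hiff k).symm
        · rw [s.perm_eq_swap, Equiv.swap_apply_right]; exact hiff k
  intro f _
  rw [pi_eq_sum_univ' f]
  refine W.sum_mem fun i _ => W.smul_mem _ ?_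
  convert hall i using 1

/-- A basis of the space of vertex sets that consists of the edges and of one vertex. -/
noncomputable def edgeBasis {s : TranspositionSeq n (n - 1)} (hs : s ∈ FDown n) (r : Fin n) :
    Module.Basis (Option (Fin (n - 1))) (ZMod 2) (Fin n → ZMod 2) :=
  basisOfTopLeSpanOfCardEqFinrank (s.rootedEdgeVec r) (top_le_span_rootedEdgeVec hs r) (by
    -- The count `(n - 1) + 1 = n` needs `n` positive, because the subtraction is truncated.
    have := r.pos
    simp
    omega)

theorem edgeBasis_apply {s : TranspositionSeq n (n - 1)} (hs : s ∈ FDown n) (r : Fin n) (o) :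
    edgeBasis hs r o = s.rootedEdgeVec r o := by
  simp [edgeBasis]

/-- `P` is (the indicator function of) a set of vertices that is left by the edge labeled `e` and by
no other edge. -/
def IsCut (s : TranspositionSeq n m) (e : Fin m) (P : Fin n → ZMod 2) : Prop :=
  P (s.lo e) ≠ P (s.hi e) ∧ ∀ k, k ≠ e → P (s.lo k) = P (s.hi k)

/-- The coordinate functional of `e` is 1 on the edge vector of `e` and 0 on the others, and an edge
vector is the sum of the unit vectors of its ends. -/
theorem isCut_edgeBasis_coord {s : TranspositionSeq n (n - 1)} (hs : s ∈ FDown n) (r : Fin n)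
    (e : Fin (n - 1)) :
    s.IsCut e fun x => (edgeBasis hs r).coord (some e) (Pi.single x 1) := by
  have key : ∀ k, (edgeBasis hs r).coord (some e) (Pi.single (s.lo k) 1) +
      (edgeBasis hs r).coord (some e) (Pi.single (s.hi k) 1) = if k = e then 1 else 0 := by
    intro k
    rw [← map_add]
    change (edgeBasis hs r).coord (some e) (s.rootedEdgeVec r (some k)) = _
    rw [← edgeBasis_apply hs]
    simp [Finsupp.single_apply]
  constructor
  · intro h
    have := key e
    simp only at h
    rw [h, CharTwo.add_self_eq_zero] at this
    simp at this
  · intro k hk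
    have := key k
    rw [if_neg hk] at this
    exact CharTwo.add_eq_zero.1 this

theorem exists_isCut {s : TranspositionSeq n (n - 1)} (hs : s ∈ FDown n) (e : Fin (n - 1)) :
    ∃ P, s.IsCut e P :=
  ⟨_, isCut_edgeBasis_coord hs (s.lo e) e⟩

theorem IsCut.perm_apply {s : TranspositionSeq n m} {e : Fin m} {P : Fin n → ZMod 2}
    (hP : s.IsCut e P) {k : Fin m} (hk : k ≠ e) (x : Fin n) : P (s.perm k x) = P x := by
  by_cases hx : s.perm k x = x
  · rw [hx]
  · rcases (s.perm_ne_iff k x).1 hx with rfl | rfl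
    · rw [s.perm_eq_swap, Equiv.swap_apply_left, hP.2 k hk]
    · rw [s.perm_eq_swap, Equiv.swap_apply_right, hP.2 k hk]

/-- The trail from `u` leads from `u` to its predecessor; so if these lie on different sides of
a cut, then the trail uses the edge of the cut. -/
theorem IsCut.migtUses_of_ne {s : TranspositionSeq n (n - 1)} (hs : s ∈ FDown n)
    {e : Fin (n - 1)} {P : Fin n → ZMod 2} (hP : s.IsCut e P) {u : Fin n}
    (hu : P ((finRotate n).symm u) ≠ P u) : s.MigtUses u e := by
  rw [migtUses_iff]
  intro hfix
  apply hu
  rw [← partialProd_of_mem_FDown hs]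
  refine s.comp_partialProd P u _ le_rfl fun k _ => ?_
  by_cases hk : k = e
  · subst hk; rw [hfix]
  · exact hP.perm_apply hk _

/-- Swap `e` takes the mind across the cut, and no other swap can bring it back. -/
theorem IsCut.ne_of_migtUses {s : TranspositionSeq n (n - 1)} (hs : s ∈ FDown n)
    {e : Fin (n - 1)} {P : Fin n → ZMod 2} (hP : s.IsCut e P) {u : Fin n}
    (hu : s.MigtUses u e) : P ((finRotate n).symm u) ≠ P u := by
  rw [migtUses_iff] at hu
  have h1 : P (s.partialProd e u) = P u :=
    s.comp_partialProd P u e (by omega) fun k hk => hP.perm_apply (by rintro rfl; omega) _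
  have h2 : P (s.perm e (s.partialProd e u)) ≠ P (s.partialProd e u) := by
    rcases (s.perm_ne_iff e _).1 hu with h | h
    · rw [h, s.perm_eq_swap, Equiv.swap_apply_left]; exact hP.1.symm
    · rw [h, s.perm_eq_swap, Equiv.swap_apply_right]; exact hP.1
  have h3 : ∀ j : ℕ, (e : ℕ) + 1 ≤ j → j ≤ n - 1 →
      P (s.partialProd j u) = P (s.partialProd (e + 1) u) := by
    intro j hj
    induction j, hj using Nat.le_induction with
    | base => intro _; rfl
    | succ j hj ih =>
      intro hjn
      have h4 := s.partialProd_succ ⟨j, by omega⟩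
      simp only at h4
      rw [h4, Equiv.Perm.mul_apply, hP.perm_apply, ih (by omega)]
      intro h
      have := congrArg Fin.val h
      simp only at this
      omega
  rw [← partialProd_of_mem_FDown hs, h3 _ (by omega) le_rfl, s.partialProd_succ,
    Equiv.Perm.mul_apply, ← h1]
  exact h2

theorem exists_change {P : Fin n → ZMod 2} {p q : Fin n} (hpq : p < q) (h : P p ≠ P q) :
    ∃ u, p < u ∧ u ≤ q ∧ P ((finRotate n).symm u) ≠ P u := by
  by_contra! hc
  apply h
  have : ∀ j : ℕ, (p : ℕ) ≤ j → ∀ hj : j ≤ q, P ⟨j, by omega⟩ = P p := by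
    intro j hj
    induction j, hj using Nat.le_induction with
    | base => intro _; rfl
    | succ j hj ih =>
      intro hjq
      rw [← ih (by omega), ← hc ⟨j + 1, by omega⟩ (by rw [Fin.lt_def]; simp; omega)
        (by rw [Fin.le_def]; simp; omega)]
      congr 1
      ext
      rw [finRotate_symm_val]; simp
  exact (this q (by rw [Fin.lt_def] at hpq; omega) le_rfl).symm

/-- The two sides of a cut do not alternate four times around the circle. -/
theorem IsCut.not_alternating {s : TranspositionSeq n (n - 1)} (hs : s ∈ FDown n)
    {e : Fin (n - 1)} {P : Fin n → ZMod 2} (hP : s.IsCut e P) {p q r t : Fin n}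
    (hpq : p < q) (hqr : q < r) (hrt : r < t) (h1 : P p ≠ P q) (h2 : P q ≠ P r)
    (h3 : P r ≠ P t) : False := by
  obtain ⟨u, hu, hu', hu''⟩ := exists_change hpq h1
  obtain ⟨v, hv, hv', hv''⟩ := exists_change hqr h2
  obtain ⟨w, hw, hw', hw''⟩ := exists_change hrt h3
  have h4 := (s.migtUses_iff_eq_or_eq u e).1 (hP.migtUses_of_ne hs hu'')
  have h5 := (s.migtUses_iff_eq_or_eq v e).1 (hP.migtUses_of_ne hs hv'')
  have h6 := (s.migtUses_iff_eq_or_eq w e).1 (hP.migtUses_of_ne hs hw'')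
  have huv : u < v := lt_of_le_of_lt hu' hv
  have hvw : v < w := lt_of_le_of_lt hv' hw
  rcases h4 with h4 | h4 <;> rcases h5 with h5 | h5 <;> rcases h6 with h6 | h6 <;>
    grind

theorem IsCut.not_separated {s : TranspositionSeq n (n - 1)} (hs : s ∈ FDown n)
    {e : Fin (n - 1)} {P : Fin n → ZMod 2} (hP : s.IsCut e P) {a b z w : Fin n}
    (haz : a < z) (hzb : z < b) (hw : w < a ∨ b < w) (hab : P a = P b) (hz : P z ≠ P a)
    (hwa : P w ≠ P a) : False := by
  rcases hw with hw | hw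
  · exact hP.not_alternating hs hw haz hzb hwa hz.symm (hab ▸ hz)
  · exact hP.not_alternating hs haz hzb hw hz.symm (hab ▸ hz) (hab ▸ hwa.symm)

/-! ### Noncrossing edges. -/

/-- Two edges without a common vertex are separated by a third edge. -/
theorem exists_isCut_separating {s : TranspositionSeq n (n - 1)} (hs : s ∈ FDown n)
    {j k : Fin (n - 1)} (h1 : s.lo j ≠ s.lo k) (h2 : s.lo j ≠ s.hi k) (h3 : s.hi j ≠ s.lo k)
    (h4 : s.hi j ≠ s.hi k) :
    ∃ e P, s.IsCut e P ∧ e ≠ j ∧ e ≠ k ∧ P (s.lo j) ≠ P (s.lo k) := by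
  by_contra! hc
  -- Otherwise, in this basis, the sum of the unit vectors at `s.lo j` and `s.lo k` has only the
  -- coordinates `j` and `k`. Its value 1 at `s.lo j` and its value 0 at `s.hi j` would both be the
  -- coefficient of `j`.
  set B := edgeBasis hs (s.lo j) with hB
  have hjk : j ≠ k := by rintro rfl; exact h1 rfl
  have hsome : ∀ e, e ≠ j → e ≠ k →
      B.repr (Pi.single (s.lo j) 1 + Pi.single (s.lo k) 1) (some e) = 0 := by
    intro e hej hek
    have := hc e _ (isCut_edgeBasis_coord hs (s.lo j) e) hej hek
    rw [← B.coord_apply, map_add, this, CharTwo.add_self_eq_zero]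
  have hnone : B.repr (Pi.single (s.lo j) 1 + Pi.single (s.lo k) 1) none = 0 := by
    -- The root coordinate is 0 on every edge vector, so it takes equal values on all unit vectors,
    -- and these cancel in the sum of two.
    have hk : ∀ k, B.coord none (Pi.single (s.lo k) 1) = B.coord none (Pi.single (s.hi k) 1) := by
      intro k
      rw [← CharTwo.add_eq_zero, ← map_add]
      change B.coord none (s.rootedEdgeVec (s.lo j) (some k)) = _
      rw [← edgeBasis_apply hs]
      simp [hB]
    have := eq_of_invariant hs (fun x => B.coord none (Pi.single x 1)) ?_ (s.lo j) (s.lo k)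
    · rw [← B.coord_apply, map_add, this, CharTwo.add_self_eq_zero]
    · intro k x
      by_cases hx : s.perm k x = x
      · rw [hx]
      · rcases (s.perm_ne_iff k x).1 hx with rfl | rfl
        · rw [s.perm_eq_swap, Equiv.swap_apply_left, hk k]
        · rw [s.perm_eq_swap, Equiv.swap_apply_right, hk k]
  have hsum := B.sum_repr (Pi.single (s.lo j) 1 + Pi.single (s.lo k) 1)
  rw [Fintype.sum_option, hnone, zero_smul, zero_add,
    Fintype.sum_eq_add j k hjk fun e he => by rw [hsome e he.1 he.2, zero_smul]] at hsum
  simp only [hB, edgeBasis_apply, rootedEdgeVec, edgeVec] at hsum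
  have hlo := congrFun hsum (s.lo j)
  have hhi := congrFun hsum (s.hi j)
  have hj := (s.lo_lt_hi j).ne
  simp [h1, h2, h3, hj, hj.symm, h4] at hlo hhi
  rw [hlo] at hhi
  exact one_ne_zero hhi

theorem not_crossing {s : TranspositionSeq n (n - 1)} (hs : s ∈ FDown n) (j k : Fin (n - 1)) :
    ¬ (s.lo j < s.lo k ∧ s.lo k < s.hi j ∧ s.hi j < s.hi k) := by
  rintro ⟨h1, h2, h3⟩
  obtain ⟨e, P, hP, hej, hek, hne⟩ := exists_isCut_separating hs (j := j) (k := k) h1.ne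
    (h1.trans (h2.trans h3)).ne h2.ne' h3.ne
  have hj := hP.2 j hej.symm
  have hk := hP.2 k hek.symm
  exact hP.not_alternating hs h1 h2 h3 hne (by rw [← hj]; exact hne.symm)
    (by rw [← hj, ← hk]; exact hne)

theorem ext_edge {s : TranspositionSeq n (n - 1)} (hs : s ∈ FDown n) {j k : Fin (n - 1)}
    (h1 : s.lo j = s.lo k) (h2 : s.hi j = s.hi k) : j = k := by
  by_contra hjk
  obtain ⟨P, hP⟩ := exists_isCut hs j
  apply hP.1
  rw [h1, h2]
  exact hP.2 k (Ne.symm hjk)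

/-- Any edge `k` lies weakly on one side of any other edge `j`. -/
theorem inside_or_outside {s : TranspositionSeq n (n - 1)} (hs : s ∈ FDown n)
    {j k : Fin (n - 1)} (hjk : j ≠ k) :
    (s.lo j ≤ s.lo k ∧ s.hi k ≤ s.hi j ∧ (s.lo j < s.lo k ∨ s.hi k < s.hi j)) ∨
    ((s.lo k ≤ s.lo j ∨ s.hi j ≤ s.lo k) ∧ (s.hi k ≤ s.lo j ∨ s.hi j ≤ s.hi k) ∧
      (s.lo k < s.lo j ∨ s.hi j < s.hi k)) := by
  have h1 := not_crossing hs j k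
  have h2 := not_crossing hs k j
  have h3 := s.lo_lt_hi j
  have h4 := s.lo_lt_hi k
  have h5 : ¬ (s.lo j = s.lo k ∧ s.hi j = s.hi k) := fun h => hjk (ext_edge hs h.1 h.2)
  omega

end TranspositionSeq

namespace CirclePoints

variable {n m : ℕ}

/-! ### The line through two labeled points -/

/-- An affine function that vanishes on the line through the points `a` and `b`, and is positive
on the side of the arc that runs from `a` to `b`. -/
noncomputable def lineFun (C : CirclePoints n) (a b : Fin n) (p : ℂ) : ℝ :=
  ((p - C.center) * Complex.exp (((C.angle a + C.angle b) / 2 : ℝ) * Complex.I)).re -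
    C.radius * Real.cos ((C.angle b - C.angle a) / 2)

theorem at_angle_sub_mul_exp (C : CirclePoints n) (φ ψ : ℝ) :
    (C.at_angle φ - C.center) * Complex.exp (ψ * Complex.I) =
      C.radius * Complex.exp ((ψ - φ : ℝ) * Complex.I) := by
  rw [at_angle, add_sub_cancel_left, mul_assoc, ← Complex.exp_add]
  congr 2
  push_cast
  ring

/-- In this product form the sign of `lineFun` on the circle can be read off from the signs of two
sines. -/
theorem lineFun_at_angle (C : CirclePoints n) (a b : Fin n) (φ : ℝ) :
    C.lineFun a b (C.at_angle φ) =
      2 * C.radius * (Real.sin ((φ - C.angle a) / 2) * Real.sin ((C.angle b - φ) / 2)) := by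
  rw [lineFun, at_angle_sub_mul_exp, Complex.re_ofReal_mul, Complex.exp_ofReal_mul_I_re]
  have h1 : (C.angle a + C.angle b) / 2 - φ =
      (C.angle b - φ) / 2 - (φ - C.angle a) / 2 := by ring
  have h2 : (C.angle b - C.angle a) / 2 = (C.angle b - φ) / 2 + (φ - C.angle a) / 2 := by ring
  rw [h1, h2, Real.cos_sub, Real.cos_add]
  ring

theorem lineFun_combo (C : CirclePoints n) (a b : Fin n) {t u : ℝ} (htu : t + u = 1) (p q : ℂ) :
    C.lineFun a b (t • p + u • q) = t * C.lineFun a b p + u * C.lineFun a b q := by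
  obtain rfl : t = 1 - u := by linarith
  simp only [lineFun, Complex.real_smul]
  have : (((1 - u : ℝ) : ℂ) * p + (u : ℂ) * q - C.center) *
      Complex.exp (((C.angle a + C.angle b) / 2 : ℝ) * Complex.I) =
      ((1 - u : ℝ) : ℂ) *
        ((p - C.center) * Complex.exp (((C.angle a + C.angle b) / 2 : ℝ) * Complex.I)) +
      (u : ℂ) *
        ((q - C.center) * Complex.exp (((C.angle a + C.angle b) / 2 : ℝ) * Complex.I)) := by
    push_cast
    ring
  rw [this, Complex.add_re, Complex.re_ofReal_mul, Complex.re_ofReal_mul]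
  ring

theorem continuous_lineFun (C : CirclePoints n) (a b : Fin n) : Continuous (C.lineFun a b) := by
  unfold lineFun
  fun_prop

theorem lineFun_pos (C : CirclePoints n) {a b : Fin n} {φ : ℝ} (h1 : C.angle a < φ)
    (h2 : φ < C.angle b) : 0 < C.lineFun a b (C.at_angle φ) := by
  have := C.angle_lt a b
  rw [lineFun_at_angle]
  refine mul_pos (mul_pos two_pos C.radius_pos) (mul_pos ?_ ?_) <;>
    exact Real.sin_pos_of_pos_of_lt_pi (by linarith) (by linarith)

theorem lineFun_neg_of_lt (C : CirclePoints n) {a b : Fin n} (hab : a < b) {φ : ℝ}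
    (h1 : C.angle b < φ) (h2 : φ < C.angle a + 2 * Real.pi) :
    C.lineFun a b (C.at_angle φ) < 0 := by
  have := C.angle_strictMono hab
  rw [lineFun_at_angle]
  refine mul_neg_of_pos_of_neg (mul_pos two_pos C.radius_pos) (mul_neg_of_pos_of_neg ?_ ?_)
  · exact Real.sin_pos_of_pos_of_lt_pi (by linarith) (by linarith)
  · exact Real.sin_neg_of_neg_of_neg_pi_lt (by linarith) (by linarith)

theorem lineFun_neg_of_gt (C : CirclePoints n) {a b : Fin n} (hab : a < b) {φ : ℝ}
    (h1 : φ < C.angle a) (h2 : C.angle b < φ + 2 * Real.pi) :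
    C.lineFun a b (C.at_angle φ) < 0 := by
  have := C.angle_strictMono hab
  rw [lineFun_at_angle]
  refine mul_neg_of_pos_of_neg (mul_pos two_pos C.radius_pos) (mul_neg_of_neg_of_pos ?_ ?_)
  · exact Real.sin_neg_of_neg_of_neg_pi_lt (by linarith) (by linarith)
  · exact Real.sin_pos_of_pos_of_lt_pi (by linarith) (by linarith)

theorem lineFun_left (C : CirclePoints n) (a b : Fin n) : C.lineFun a b (C.point a) = 0 := by
  simp [point, lineFun_at_angle]

theorem lineFun_right (C : CirclePoints n) (a b : Fin n) : C.lineFun a b (C.point b) = 0 := by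
  simp [point, lineFun_at_angle]

theorem lineFun_point_pos (C : CirclePoints n) {a b x : Fin n} (h1 : a < x) (h2 : x < b) :
    0 < C.lineFun a b (C.point x) :=
  C.lineFun_pos (C.angle_strictMono h1) (C.angle_strictMono h2)

theorem lineFun_point_neg (C : CirclePoints n) {a b x : Fin n} (hab : a < b)
    (h : x < a ∨ b < x) : C.lineFun a b (C.point x) < 0 := by
  rcases h with h | h
  · exact C.lineFun_neg_of_gt hab (C.angle_strictMono h) (C.angle_lt _ _)
  · exact C.lineFun_neg_of_lt hab (C.angle_strictMono h) (C.angle_lt _ _)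

theorem at_angle_mem_closedBall (C : CirclePoints n) (φ : ℝ) :
    C.at_angle φ ∈ Metric.closedBall C.center C.radius := by
  have : Complex.exp (-(φ * Complex.I)) = Complex.exp ((-φ : ℝ) * Complex.I) := by
    push_cast; ring_nf
  rw [mem_closedBall_iff_norm, at_angle, add_sub_cancel_left, norm_mul, this,
    Complex.norm_exp_ofReal_mul_I, mul_one, Complex.norm_real, Real.norm_eq_abs,
    abs_of_pos C.radius_pos]

/-- A chord is the part of its line that lies in the disk. -/
theorem segment_eq (C : CirclePoints n) {a b : Fin n} (hab : a < b) :
    segment ℝ (C.point a) (C.point b) =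
      {p | p ∈ Metric.closedBall C.center C.radius ∧ C.lineFun a b p = 0} := by
  ext p
  constructor
  · intro hp
    refine ⟨(convex_closedBall _ _).segment_subset (C.at_angle_mem_closedBall _)
      (C.at_angle_mem_closedBall _) hp, ?_⟩
    obtain ⟨t, u, _, _, htu, rfl⟩ := hp
    rw [lineFun_combo C a b htu, lineFun_left, lineFun_right]
    simp
  · rintro ⟨hball, hline⟩
    set μ : ℝ := (C.angle a + C.angle b) / 2 with hμ
    set δ : ℝ := (C.angle b - C.angle a) / 2 with hδ
    set r := C.radius with hr
    have hr0 : 0 < r := C.radius_pos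
    have hlt := C.angle_strictMono hab
    have hlt2 := C.angle_lt a b
    -- Multiplication by `w` below turns the chord upright: its line becomes `re = r cos δ`, with
    -- the ends at heights `± r sin δ`.
    have hsin : 0 < Real.sin δ := Real.sin_pos_of_pos_of_lt_pi (by linarith) (by linarith)
    set w := Complex.exp (μ * Complex.I) with hw
    have hw0 : w ≠ 0 := Complex.exp_ne_zero _
    set q := (p - C.center) * w with hq
    have hre : q.re = r * Real.cos δ := by
      have : q.re - r * Real.cos δ = 0 := hline
      linarith
    have hnorm : q.re ^ 2 + q.im ^ 2 ≤ r ^ 2 := by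
      rw [mem_closedBall_iff_norm] at hball
      have h1 : ‖q‖ ≤ r := by
        rw [hq, norm_mul, hw, Complex.norm_exp_ofReal_mul_I, mul_one]; exact hball
      have h2 : ‖q‖ ^ 2 ≤ r ^ 2 := pow_le_pow_left₀ (norm_nonneg _) h1 2
      rw [← Complex.normSq_eq_norm_sq, Complex.normSq_apply] at h2
      linarith
    have him : |q.im| ≤ r * Real.sin δ := by
      apply abs_le_of_sq_le_sq _ (by positivity)
      have := Real.sin_sq_add_cos_sq δ
      rw [hre] at hnorm
      have h3 : (r * Real.sin δ) ^ 2 = r ^ 2 - (r * Real.cos δ) ^ 2 := by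
        rw [mul_pow, mul_pow]; linear_combination r ^ 2 * this
      linarith
    obtain ⟨him1, him2⟩ := abs_le.1 him
    have hrs : 0 < r * Real.sin δ := mul_pos hr0 hsin
    -- The height of `q` relative to the half-chord; `t = 1` is the point `a` and `t = -1` the point
    -- `b`.
    set t : ℝ := q.im / (r * Real.sin δ) with ht
    have ht1 : t ≤ 1 := (div_le_one hrs).2 him2
    have ht2 : -1 ≤ t := by rw [ht, le_div_iff₀ hrs]; linarith
    have him3 : q.im = t * (r * Real.sin δ) := by rw [ht]; field_simp
    refine ⟨(1 + t) / 2, (1 - t) / 2, by linarith, by linarith, by ring, ?_⟩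
    have hA : (C.point a - C.center) * w = r * Complex.exp (δ * Complex.I) := by
      rw [point, hw, at_angle_sub_mul_exp, hδ, hμ]
      congr 4
      ring
    have hB : (C.point b - C.center) * w = r * Complex.exp ((-δ : ℝ) * Complex.I) := by
      rw [point, hw, at_angle_sub_mul_exp, hδ, hμ]
      congr 4
      ring
    have key : (((1 + t) / 2 : ℝ) : ℂ) * ((C.point a - C.center) * w) +
        (((1 - t) / 2 : ℝ) : ℂ) * ((C.point b - C.center) * w) = q := by
      rw [hA, hB]
      apply Complex.ext
      · rw [Complex.add_re, Complex.re_ofReal_mul, Complex.re_ofReal_mul, Complex.re_ofReal_mul,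
          Complex.re_ofReal_mul, Complex.exp_ofReal_mul_I_re, Complex.exp_ofReal_mul_I_re,
          Real.cos_neg, hre]
        ring
      · rw [Complex.add_im, Complex.im_ofReal_mul, Complex.im_ofReal_mul, Complex.im_ofReal_mul,
          Complex.im_ofReal_mul, Complex.exp_ofReal_mul_I_im, Complex.exp_ofReal_mul_I_im,
          Real.sin_neg, him3]
        ring
    rw [Complex.real_smul, Complex.real_smul]
    apply mul_right_cancel₀ hw0
    rw [hq] at key
    have h4 : (((1 + t) / 2 : ℝ) : ℂ) + (((1 - t) / 2 : ℝ) : ℂ) = 1 := by push_cast; ring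
    linear_combination key + C.center * w * h4

/-! ### The sides of a chord -/

/-- The line function of the chord labeled `k`. -/
noncomputable def side (C : CirclePoints n) (s : TranspositionSeq n m) (k : Fin m) : ℂ → ℝ :=
  C.lineFun (s.lo k) (s.hi k)

theorem chord_eq_segment (C : CirclePoints n) (s : TranspositionSeq n m) (k : Fin m) :
    C.chord s k = segment ℝ (C.point (s.lo k)) (C.point (s.hi k)) := by
  ext p
  simp only [chord, Set.mem_ofPred_eq]
  constructor
  · rintro ⟨x, hx, hp⟩
    rcases (s.perm_ne_iff k x).1 hx with rfl | rfl
    · rwa [s.perm_eq_swap, Equiv.swap_apply_left] at hp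
    · rwa [s.perm_eq_swap, Equiv.swap_apply_right, segment_symm] at hp
  · intro hp
    refine ⟨s.lo k, (s.perm_ne_iff k _).2 (Or.inl rfl), ?_⟩
    rwa [s.perm_eq_swap, Equiv.swap_apply_left]

theorem mem_chord_iff (C : CirclePoints n) (s : TranspositionSeq n m) (k : Fin m) (p : ℂ) :
    p ∈ C.chord s k ↔ p ∈ Metric.closedBall C.center C.radius ∧ C.side s k p = 0 := by
  rw [chord_eq_segment, segment_eq C (s.lo_lt_hi k)]
  rfl

theorem mem_chordComplement_iff (C : CirclePoints n) (s : TranspositionSeq n m) (p : ℂ) :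
    p ∈ C.chordComplement s ↔
      p ∈ Metric.closedBall C.center C.radius ∧ ∀ k, C.side s k p ≠ 0 := by
  simp only [chordComplement, Set.mem_sdiff, Set.mem_iUnion, mem_chord_iff, not_exists]
  grind

/-- The points of the disk that lie on the same side of each chord as `p`. -/
noncomputable def cell (C : CirclePoints n) (s : TranspositionSeq n m) (p : ℂ) : Set ℂ :=
  {q | q ∈ Metric.closedBall C.center C.radius ∧ ∀ k, 0 < C.side s k p * C.side s k q}

theorem side_combo (C : CirclePoints n) (s : TranspositionSeq n m) (k : Fin m) {t u : ℝ}
    (htu : t + u = 1) (p q : ℂ) :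
    C.side s k (t • p + u • q) = t * C.side s k p + u * C.side s k q :=
  C.lineFun_combo _ _ htu p q

theorem continuous_side (C : CirclePoints n) (s : TranspositionSeq n m) (k : Fin m) :
    Continuous (C.side s k) :=
  C.continuous_lineFun _ _

theorem convex_cell (C : CirclePoints n) (s : TranspositionSeq n m) (p : ℂ) :
    Convex ℝ (C.cell s p) := by
  intro q hq q' hq' t u ht hu htu
  refine ⟨convex_closedBall _ _ hq.1 hq'.1 ht hu htu, fun k => ?_⟩
  rw [C.side_combo s k htu]
  have h1 := hq.2 k
  have h2 := hq'.2 k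
  rw [mul_add, mul_left_comm, mul_left_comm _ u]
  rcases ht.eq_or_lt with rfl | ht
  · obtain rfl : u = 1 := by linarith
    simpa using h2
  · have := mul_pos ht h1
    have := mul_nonneg hu h2.le
    linarith

theorem cell_subset_chordComplement (C : CirclePoints n) (s : TranspositionSeq n m) (p : ℂ) :
    C.cell s p ⊆ C.chordComplement s := by
  intro q hq
  rw [mem_chordComplement_iff]
  exact ⟨hq.1, fun k h => by simpa [h] using hq.2 k⟩

theorem mem_cell_self (C : CirclePoints n) (s : TranspositionSeq n m) {p : ℂ}
    (hp : p ∈ C.chordComplement s) : p ∈ C.cell s p := by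
  rw [mem_chordComplement_iff] at hp
  exact ⟨hp.1, fun k => mul_self_pos.2 (hp.2 k)⟩

theorem mul_pos_of_isPreconnected {S : Set ℂ} (hS : IsPreconnected S) {f : ℂ → ℝ}
    (hf : Continuous f) (h0 : ∀ q ∈ S, f q ≠ 0) {p q : ℂ} (hp : p ∈ S) (hq : q ∈ S) :
    0 < f p * f q := by
  by_contra hc
  have hp0 := h0 p hp
  have hq0 := h0 q hq
  have h1 := hS.intermediate_value hp hq hf.continuousOn
  have h2 := hS.intermediate_value hq hp hf.continuousOn
  have : ∃ z ∈ S, f z = 0 := by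
    rcases lt_or_gt_of_ne hp0 with h | h <;> rcases lt_or_gt_of_ne hq0 with h' | h'
    · exact absurd (mul_pos_of_neg_of_neg h h') hc
    · exact h1 ⟨h.le, h'.le⟩
    · exact h2 ⟨h'.le, h.le⟩
    · exact absurd (mul_pos h h') hc
  obtain ⟨z, hz, hz0⟩ := this
  exact h0 z hz hz0

/-- No sign changes on a connected set that avoids the chords; conversely a cell is convex, hence
connected. -/
theorem connectedComponentIn_eq_cell (C : CirclePoints n) (s : TranspositionSeq n m) {p : ℂ}
    (hp : p ∈ C.chordComplement s) :
    connectedComponentIn (C.chordComplement s) p = C.cell s p := by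
  apply Set.Subset.antisymm
  · intro q hq
    have hsub := connectedComponentIn_subset (C.chordComplement s) p
    refine ⟨((C.mem_chordComplement_iff s q).1 (hsub hq)).1, fun k => ?_⟩
    exact mul_pos_of_isPreconnected isPreconnected_connectedComponentIn (C.continuous_side s k)
      (fun z hz => ((C.mem_chordComplement_iff s z).1 (hsub hz)).2 k)
      (mem_connectedComponentIn hp) hq
  · exact (C.convex_cell s p).isPreconnected.subset_connectedComponentIn (C.mem_cell_self s hp)
      (C.cell_subset_chordComplement s p)

theorem cell_eq_of_mem (C : CirclePoints n) (s : TranspositionSeq n m) {p q : ℂ}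
    (hq : q ∈ C.cell s p) : C.cell s p = C.cell s q := by
  ext z
  refine and_congr_right fun _ => forall_congr' fun k => ?_
  rcases pos_and_pos_or_neg_and_neg_of_mul_pos (hq.2 k) with ⟨h1, h2⟩ | ⟨h1, h2⟩
  · rw [mul_pos_iff_of_pos_left h1, mul_pos_iff_of_pos_left h2]
  · rw [mul_pos_iff, mul_pos_iff]
    simp [h1, h2, h1.not_gt, h2.not_gt]

/-! ### The arcs -/

theorem prevAngle_lt (C : CirclePoints n) (u : Fin n) : C.prevAngle u < C.angle u := by
  rw [prevAngle]
  split_ifs with h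
  · linarith [C.angle_lt u ((finRotate n).symm u)]
  · apply C.angle_strictMono
    rw [Fin.lt_def, TranspositionSeq.finRotate_symm_val, if_neg h]
    omega

/-- With `angle_le_prevAngle_add`, this keeps labeled points out of the open arc `u`, including at
the wrap-around, so the whole arc lies on one side of each chord. -/
theorem angle_le_prevAngle (C : CirclePoints n) {x u : Fin n} (h : x < u) :
    C.angle x ≤ C.prevAngle u := by
  have hu : (u : ℕ) ≠ 0 := by omega
  rw [prevAngle, if_neg hu]
  apply C.angle_strictMono.monotone
  rw [Fin.le_def, TranspositionSeq.finRotate_symm_val, if_neg hu]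
  omega

theorem angle_le_prevAngle_add (C : CirclePoints n) (x u : Fin n) :
    C.angle x ≤ C.prevAngle u + 2 * Real.pi := by
  rw [prevAngle]
  split_ifs with h
  · have : C.angle x ≤ C.angle ((finRotate n).symm u) := by
      apply C.angle_strictMono.monotone
      rw [Fin.le_def, TranspositionSeq.finRotate_symm_val, if_pos h]
      omega
    linarith
  · exact (C.angle_lt _ _).le

theorem side_pos_of_arc (C : CirclePoints n) (s : TranspositionSeq n m) {k : Fin m} {u : Fin n}
    (h1 : s.lo k < u) (h2 : u ≤ s.hi k) {p : ℂ} (hp : p ∈ C.arc u) : 0 < C.side s k p := by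
  obtain ⟨φ, ⟨hφ1, hφ2⟩, rfl⟩ := hp
  exact C.lineFun_pos ((C.angle_le_prevAngle h1).trans_lt hφ1)
    (hφ2.trans_le (C.angle_strictMono.monotone h2))

theorem side_neg_of_arc (C : CirclePoints n) (s : TranspositionSeq n m) {k : Fin m} {u : Fin n}
    (h : u ≤ s.lo k ∨ s.hi k < u) {p : ℂ} (hp : p ∈ C.arc u) : C.side s k p < 0 := by
  obtain ⟨φ, ⟨hφ1, hφ2⟩, rfl⟩ := hp
  rcases h with h | h
  · refine C.lineFun_neg_of_gt (s.lo_lt_hi k)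
      (hφ2.trans_le (C.angle_strictMono.monotone h)) ?_
    linarith [C.angle_le_prevAngle_add (s.hi k) u]
  · exact C.lineFun_neg_of_lt (s.lo_lt_hi k) ((C.angle_le_prevAngle h).trans_lt hφ1)
      (hφ2.trans (C.angle_lt _ _))

/-- The midpoint of arc `u`. -/
noncomputable def arcMid (C : CirclePoints n) (u : Fin n) : ℂ :=
  C.at_angle ((C.prevAngle u + C.angle u) / 2)

theorem arcMid_mem_arc (C : CirclePoints n) (u : Fin n) : C.arcMid u ∈ C.arc u := by
  have := C.prevAngle_lt u
  exact ⟨_, ⟨by linarith, by linarith⟩, rfl⟩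

theorem side_arc_mul_pos (C : CirclePoints n) (s : TranspositionSeq n m) (k : Fin m) {u : Fin n}
    {p q : ℂ} (hp : p ∈ C.arc u) (hq : q ∈ C.arc u) : 0 < C.side s k p * C.side s k q := by
  by_cases h : s.lo k < u ∧ u ≤ s.hi k
  · exact mul_pos (C.side_pos_of_arc s h.1 h.2 hp) (C.side_pos_of_arc s h.1 h.2 hq)
  · have h' : u ≤ s.lo k ∨ s.hi k < u := by omega
    exact mul_pos_of_neg_of_neg (C.side_neg_of_arc s h' hp) (C.side_neg_of_arc s h' hq)

theorem arc_subset_cell (C : CirclePoints n) (s : TranspositionSeq n m) (u : Fin n) :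
    C.arc u ⊆ C.cell s (C.arcMid u) := by
  intro p hp
  refine ⟨?_, fun k => C.side_arc_mul_pos s k (C.arcMid_mem_arc u) hp⟩
  obtain ⟨φ, _, rfl⟩ := hp
  exact C.at_angle_mem_closedBall φ

theorem arcMid_mem_chordComplement (C : CirclePoints n) (s : TranspositionSeq n m) (u : Fin n) :
    C.arcMid u ∈ C.chordComplement s :=
  C.cell_subset_chordComplement s _ (C.arc_subset_cell s u (C.arcMid_mem_arc u))

theorem isRegionOf_iff (C : CirclePoints n) (s : TranspositionSeq n m) (u : Fin n) (R : Set ℂ) :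
    C.IsRegionOf s u R ↔ R = C.cell s (C.arcMid u) := by
  constructor
  · rintro ⟨⟨p, hp, rfl⟩, harc⟩
    rw [C.connectedComponentIn_eq_cell s hp] at harc ⊢
    exact C.cell_eq_of_mem s (harc (C.arcMid_mem_arc u))
  · rintro rfl
    have h := C.arcMid_mem_chordComplement s u
    exact ⟨⟨_, h, (C.connectedComponentIn_eq_cell s h).symm⟩, C.arc_subset_cell s u⟩

end CirclePoints

/-! ### Chord midpoints and noncrossing chords. -/

namespace CirclePoints

variable {n m : ℕ}

/-- The midpoint of the chord labeled `k`. -/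
noncomputable def chordMid (C : CirclePoints n) (s : TranspositionSeq n m) (k : Fin m) : ℂ :=
  (1 / 2 : ℝ) • C.point (s.lo k) + (1 / 2 : ℝ) • C.point (s.hi k)

theorem chordMid_mem_chord (C : CirclePoints n) (s : TranspositionSeq n m) (k : Fin m) :
    C.chordMid s k ∈ C.chord s k := by
  rw [chord_eq_segment]
  exact ⟨1 / 2, 1 / 2, by norm_num, by norm_num, by norm_num, rfl⟩

theorem side_chordMid (C : CirclePoints n) (s : TranspositionSeq n m) (j k : Fin m) :
    C.side s j (C.chordMid s k) =
      (C.side s j (C.point (s.lo k)) + C.side s j (C.point (s.hi k))) / 2 := by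
  rw [chordMid, side_combo _ _ _ (by norm_num)]
  ring

theorem side_point_nonneg (C : CirclePoints n) (s : TranspositionSeq n m) {j : Fin m} {x : Fin n}
    (h1 : s.lo j ≤ x) (h2 : x ≤ s.hi j) : 0 ≤ C.side s j (C.point x) := by
  rcases h1.eq_or_lt with rfl | h1
  · exact (C.lineFun_left _ _).ge
  rcases h2.eq_or_lt with rfl | h2
  · exact (C.lineFun_right _ _).ge
  exact (C.lineFun_point_pos h1 h2).le

theorem side_point_nonpos (C : CirclePoints n) (s : TranspositionSeq n m) {j : Fin m} {x : Fin n}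
    (h : x ≤ s.lo j ∨ s.hi j ≤ x) : C.side s j (C.point x) ≤ 0 := by
  rcases h with h | h
  · rcases h.eq_or_lt with rfl | h
    · exact (C.lineFun_left _ _).le
    · exact (C.lineFun_point_neg (s.lo_lt_hi j) (Or.inl h)).le
  · rcases h.eq_or_lt with h | h
    · rw [← h]; exact (C.lineFun_right _ _).le
    · exact (C.lineFun_point_neg (s.lo_lt_hi j) (Or.inr h)).le

/-- The ends of a chord lie weakly, but not both strictly, on one side of any other chord. -/
theorem side_ends {s : TranspositionSeq n (n - 1)} (hs : s ∈ FDown n) (C : CirclePoints n)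
    {j k : Fin (n - 1)} (hjk : j ≠ k) :
    (0 ≤ C.side s j (C.point (s.lo k)) ∧ 0 ≤ C.side s j (C.point (s.hi k)) ∧
      0 < C.side s j (C.chordMid s k) ∧ s.lo j ≤ s.lo k ∧ s.hi k ≤ s.hi j) ∨
    (C.side s j (C.point (s.lo k)) ≤ 0 ∧ C.side s j (C.point (s.hi k)) ≤ 0 ∧
      C.side s j (C.chordMid s k) < 0 ∧ (s.lo k ≤ s.lo j ∨ s.hi j ≤ s.lo k) ∧
      (s.hi k ≤ s.lo j ∨ s.hi j ≤ s.hi k)) := by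
  have hj := s.lo_lt_hi j
  have hk := s.lo_lt_hi k
  rw [side_chordMid]
  rcases TranspositionSeq.inside_or_outside hs hjk with ⟨h1, h2, h3⟩ | ⟨h1, h2, h3⟩
  · have ha := C.side_point_nonneg s (x := s.lo k) h1 (by omega)
    have hb := C.side_point_nonneg s (x := s.hi k) (by omega) h2
    refine Or.inl ⟨ha, hb, ?_, h1, h2⟩
    rcases h3 with h3 | h3
    · have : 0 < C.side s j (C.point (s.lo k)) := C.lineFun_point_pos h3 (by omega)
      linarith
    · have : 0 < C.side s j (C.point (s.hi k)) := C.lineFun_point_pos (by omega) h3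
      linarith
  · have ha := C.side_point_nonpos s h1
    have hb := C.side_point_nonpos s h2
    refine Or.inr ⟨ha, hb, ?_, h1, h2⟩
    rcases h3 with h3 | h3
    · have : C.side s j (C.point (s.lo k)) < 0 := C.lineFun_point_neg hj (Or.inl h3)
      linarith
    · have : C.side s j (C.point (s.hi k)) < 0 := C.lineFun_point_neg hj (Or.inr h3)
      linarith

theorem side_chordMid_ne_zero {s : TranspositionSeq n (n - 1)} (hs : s ∈ FDown n)
    (C : CirclePoints n) {j k : Fin (n - 1)} (hjk : j ≠ k) : C.side s j (C.chordMid s k) ≠ 0 := by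
  rcases side_ends hs C hjk with h | h
  · exact h.2.2.1.ne'
  · exact h.2.2.1.ne

theorem side_mul_chordMid_nonneg {s : TranspositionSeq n (n - 1)} (hs : s ∈ FDown n)
    (C : CirclePoints n) {j k : Fin (n - 1)} (hjk : j ≠ k) {p : ℂ} (hp : p ∈ C.chord s k) :
    0 ≤ C.side s j p * C.side s j (C.chordMid s k) := by
  rw [chord_eq_segment] at hp
  obtain ⟨t, u, ht, hu, htu, rfl⟩ := hp
  rw [side_combo _ _ _ htu]
  rcases side_ends hs C hjk with ⟨h1, h2, h3, -⟩ | ⟨h1, h2, h3, -⟩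
  · exact mul_nonneg (add_nonneg (mul_nonneg ht h1) (mul_nonneg hu h2)) h3.le
  · exact mul_nonneg_of_nonpos_of_nonpos (add_nonpos (mul_nonpos_of_nonneg_of_nonpos ht h1)
      (mul_nonpos_of_nonneg_of_nonpos hu h2)) h3.le

theorem nonCrossing {s : TranspositionSeq n (n - 1)} (hs : s ∈ FDown n) (C : CirclePoints n) :
    C.NonCrossing s := by
  rintro j k hjk p ⟨hpj, hpk⟩
  have hp0 := ((C.mem_chord_iff s j p).1 hpj).2
  rw [chord_eq_segment] at hpk
  obtain ⟨t, u, ht, hu, htu, rfl⟩ := hpk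
  rw [side_combo _ _ _ htu] at hp0
  have hmid := C.side_chordMid s j k
  -- An interior point of chord `k` on chord `j` would force both ends of `k` onto the line of `j`,
  -- because they lie weakly on the same side; but the midpoint of `k` is off that line.
  have hzero : t = 0 ∨ u = 0 := by
    by_contra! hc
    have ht' := lt_of_le_of_ne ht hc.1.symm
    have hu' := lt_of_le_of_ne hu hc.2.symm
    rcases side_ends hs C hjk with ⟨h1, h2, h3, -⟩ | ⟨h1, h2, h3, -⟩
    · have h4 : C.side s j (C.point (s.lo k)) = 0 := by nlinarith [mul_nonneg hu h2]
      have h5 : C.side s j (C.point (s.hi k)) = 0 := by nlinarith [mul_nonneg ht h1]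
      rw [h4, h5] at hmid
      linarith
    · have h4 : C.side s j (C.point (s.lo k)) = 0 := by
        nlinarith [mul_nonpos_of_nonneg_of_nonpos hu h2]
      have h5 : C.side s j (C.point (s.hi k)) = 0 := by
        nlinarith [mul_nonpos_of_nonneg_of_nonpos ht h1]
      rw [h4, h5] at hmid
      linarith
  rcases hzero with rfl | rfl
  · obtain rfl : u = 1 := by linarith
    exact ⟨s.hi k, by simp⟩
  · obtain rfl : t = 1 := by linarith
    exact ⟨s.lo k, by simp⟩

/-! ### Counting the regions -/

open Classical in
/-- The sides of the chords in `K` on which `p` lies. -/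
noncomputable def sideVec (C : CirclePoints n) (s : TranspositionSeq n m) (K : Finset (Fin m))
    (p : ℂ) : Fin m → Bool :=
  fun k => decide (k ∈ K ∧ 0 < C.side s k p)

open Classical in
/-- The side vectors that occur in the disk without the chords. -/
noncomputable def sideVecs (C : CirclePoints n) (s : TranspositionSeq n m) (K : Finset (Fin m)) :
    Finset (Fin m → Bool) :=
  Finset.univ.filter fun τ => ∃ p ∈ C.chordComplement s, C.sideVec s K p = τ

/-- The point `z` is where the segment from `p` to `q` meets the chord. -/
theorem exists_mem_chord_of_neg_of_pos (C : CirclePoints n) (s : TranspositionSeq n m) {k : Fin m}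
    {p q : ℂ} (hp : p ∈ C.chordComplement s) (hq : q ∈ C.chordComplement s)
    (h1 : C.side s k p < 0) (h2 : 0 < C.side s k q) : ∃ z ∈ C.chord s k,
      ∀ j, 0 < C.side s j p * C.side s j q → 0 < C.side s j q * C.side s j z := by
  rw [mem_chordComplement_iff] at hp hq
  obtain ⟨z, hz, hz0⟩ := (convex_segment (𝕜 := ℝ) p q).isPreconnected.intermediate_value
    (left_mem_segment ℝ p q) (right_mem_segment ℝ p q) (C.continuous_side s k).continuousOn
    (Set.mem_Icc.2 ⟨h1.le, h2.le⟩)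
  refine ⟨z, (C.mem_chord_iff s k z).2
    ⟨(convex_closedBall _ _).segment_subset hp.1 hq.1 hz, hz0⟩, fun j hj => ?_⟩
  obtain ⟨t, u, ht, hu, htu, rfl⟩ := hz
  rw [C.side_combo s j htu]
  have h3 : 0 < C.side s j q * C.side s j q := mul_self_pos.2 (hq.2 j)
  rcases ht.eq_or_lt with rfl | ht
  · obtain rfl : u = 1 := by linarith
    simpa using h3
  · have := mul_pos ht hj
    have := mul_nonneg hu h3.le
    linarith

theorem pos_iff_pos_iff_mul_pos {x y : ℝ} (hx : x ≠ 0) (hy : y ≠ 0) :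
    (0 < x ↔ 0 < y) ↔ 0 < x * y := by
  rcases lt_or_gt_of_ne hx with h | h <;> rcases lt_or_gt_of_ne hy with h' | h' <;>
    simp [mul_pos_iff, h, h', h.not_gt, h'.not_gt]

theorem side_pos_iff_of_sideVec_eq (C : CirclePoints n) (s : TranspositionSeq n m)
    {K : Finset (Fin m)} {p q : ℂ} {j : Fin m} (hj : j ∈ K)
    (h : C.sideVec s K p j = C.sideVec s K q j) : 0 < C.side s j p ↔ 0 < C.side s j q := by
  simpa [sideVec, hj] using h

/-- If two points are on the same sides of the chords in `K` but on different sides of the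
chord `k`, then their sides are those of the chord `k`. -/
theorem sideVec_eq_chordMid {s : TranspositionSeq n (n - 1)} (hs : s ∈ FDown n)
    (C : CirclePoints n) {K : Finset (Fin (n - 1))} {k : Fin (n - 1)} (hk : k ∉ K) {p q : ℂ}
    (hp : p ∈ C.chordComplement s) (hq : q ∈ C.chordComplement s)
    (h : ∀ j ∈ K, (0 < C.side s j p ↔ 0 < C.side s j q))
    (h1 : ¬ 0 < C.side s k p) (h2 : 0 < C.side s k q) :
    C.sideVec s K q = C.sideVec s K (C.chordMid s k) := by
  have hp' := ((C.mem_chordComplement_iff s p).1 hp).2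
  have hq' := ((C.mem_chordComplement_iff s q).1 hq).2
  obtain ⟨z, hz, hzj⟩ := C.exists_mem_chord_of_neg_of_pos s hp hq
    (lt_of_le_of_ne (not_lt.1 h1) (hp' k)) h2
  funext j
  by_cases hj : j ∈ K
  · have hjk : j ≠ k := by rintro rfl; exact hk hj
    have h3 := hzj j ((pos_iff_pos_iff_mul_pos (hp' j) (hq' j)).1 (h j hj))
    have h4 := side_mul_chordMid_nonneg hs C hjk hz
    have h5 := side_chordMid_ne_zero hs C hjk
    have h6 : C.side s j z ≠ 0 := by
      intro h0; rw [h0, mul_zero] at h3; exact h3.ne rfl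
    have h7 := (pos_iff_pos_iff_mul_pos (hq' j) h6).2 h3
    have h8 := (pos_iff_pos_iff_mul_pos h6 h5).2 (lt_of_le_of_ne h4 (mul_ne_zero h6 h5).symm)
    simp [sideVec, hj, h7, h8]
  · simp [sideVec, hj]

/-- As `sideVec` is `false` outside `K`, forgetting a chord means overwriting its entry by `false`.
-/
theorem update_sideVec_insert (C : CirclePoints n) (s : TranspositionSeq n m)
    {K : Finset (Fin m)} {k : Fin m} (hk : k ∉ K) (p : ℂ) :
    Function.update (C.sideVec s (insert k K) p) k false = C.sideVec s K p := by
  funext j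
  by_cases hj : j = k
  · subst hj; simp [sideVec, hk]
  · simp [sideVec, hj]

/-- A new chord `k` can split only the old cell that contains its midpoint, so at most one sign
vector is gained. -/
theorem card_sideVecs_le {s : TranspositionSeq n (n - 1)} (hs : s ∈ FDown n) (C : CirclePoints n)
    (K : Finset (Fin (n - 1))) : (C.sideVecs s K).card ≤ K.card + 1 := by
  classical
  induction K using Finset.induction_on with
  | empty =>
    refine Finset.card_le_one.2 fun a ha b hb => ?_
    simp only [sideVecs, Finset.mem_filter, Finset.mem_univ, true_and] at ha hb
    obtain ⟨p, -, rfl⟩ := ha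
    obtain ⟨q, -, rfl⟩ := hb
    funext k
    simp [sideVec]
  | insert k K hk ih =>
    rw [Finset.card_insert_of_notMem hk]
    -- The positive half of the split cell. Without `τ`, forgetting the entry `k` is injective.
    set τ := Function.update (C.sideVec s K (C.chordMid s k)) k true with hτ
    have hdiff : ∀ p ∈ C.chordComplement s, ∀ q ∈ C.chordComplement s,
        C.sideVec s K p = C.sideVec s K q → ¬ 0 < C.side s k p → 0 < C.side s k q →
        C.sideVec s (insert k K) q = τ := by
      intro p hp q hq hpq h1 h2
      have := sideVec_eq_chordMid hs C hk hp hq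
        (fun j hj => C.side_pos_iff_of_sideVec_eq s hj (congrFun hpq j)) h1 h2
      rw [hτ, ← this, ← C.update_sideVec_insert s hk q, Function.update_idem,
        Function.eq_update_iff]
      exact ⟨by simp [sideVec, h2], fun _ _ => rfl⟩
    have hle : ((C.sideVecs s (insert k K)).erase τ).card ≤ (C.sideVecs s K).card := by
      refine Finset.card_le_card_of_injOn (fun σ => Function.update σ k false) ?_ ?_
      · intro σ hσ
        simp only [sideVecs, Finset.coe_erase, Finset.coe_filter, Finset.mem_univ, true_and,
          Set.mem_sdiff, Set.mem_ofPred_eq] at hσ ⊢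
        obtain ⟨⟨p, hp, rfl⟩, -⟩ := hσ
        exact ⟨p, hp, (C.update_sideVec_insert s hk p).symm⟩
      · intro σ hσ σ' hσ' heq
        simp only [sideVecs, Finset.coe_erase, Finset.coe_filter, Finset.mem_univ, true_and,
          Set.mem_sdiff, Set.mem_ofPred_eq, Set.mem_singleton_iff] at hσ hσ'
        obtain ⟨⟨p, hp, rfl⟩, hpτ⟩ := hσ
        obtain ⟨⟨q, hq, rfl⟩, hqτ⟩ := hσ'
        simp only [C.update_sideVec_insert s hk] at heq
        have hk' : C.sideVec s (insert k K) p k = C.sideVec s (insert k K) q k := by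
          by_cases h1 : 0 < C.side s k p <;> by_cases h2 : 0 < C.side s k q
          · simp [sideVec, h1, h2]
          · exact absurd (hdiff q hq p hp heq.symm h2 h1) hpτ
          · exact absurd (hdiff p hp q hq heq h1 h2) hqτ
          · simp [sideVec, h1, h2]
        funext j
        by_cases hj : j = k
        · rw [hj]; exact hk'
        · have := congrFun heq j
          simpa [sideVec, hj] using this
    have := Finset.pred_card_le_card_erase (s := C.sideVecs s (insert k K)) (a := τ)
    omega

theorem side_arcMid_ne_zero (C : CirclePoints n) (s : TranspositionSeq n m) (k : Fin m)
    (u : Fin n) : C.side s k (C.arcMid u) ≠ 0 :=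
  ((C.mem_chordComplement_iff s _).1 (C.arcMid_mem_chordComplement s u)).2 k

theorem side_arcMid_pos_iff (C : CirclePoints n) (s : TranspositionSeq n m) (k : Fin m)
    (u : Fin n) : 0 < C.side s k (C.arcMid u) ↔ s.lo k < u ∧ u ≤ s.hi k := by
  constructor
  · intro h
    by_contra hc
    exact h.not_gt (C.side_neg_of_arc s (by omega) (C.arcMid_mem_arc u))
  · rintro ⟨h1, h2⟩
    exact C.side_pos_of_arc s h1 h2 (C.arcMid_mem_arc u)

/-- Some chord separates two given arcs. -/
theorem arc_eq_of_forall {s : TranspositionSeq n (n - 1)} (hs : s ∈ FDown n) (C : CirclePoints n)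
    {u v : Fin n}
    (h : ∀ k, 0 < C.side s k (C.arcMid u) ↔ 0 < C.side s k (C.arcMid v)) : u = v := by
  simp only [side_arcMid_pos_iff] at h
  wlog huv : u < v generalizing u v
  · rcases (not_lt.1 huv).eq_or_lt with h' | h'
    · exact h'.symm
    · exact (this (fun k => (h k).symm) h').symm
  exfalso
  -- An edge with just one end in the interval from `u` to `v - 1` would separate the arcs `u` and
  -- `v`. Without such an edge the interval is invariant, yet it contains `u` and not `v`.
  have := TranspositionSeq.eq_of_invariant hs (fun x => u ≤ x ∧ x < v) ?_ u v
  · simp only [eq_iff_iff] at this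
    exact absurd (this.1 ⟨le_rfl, huv⟩).2 (lt_irrefl v)
  · intro k x
    have hk := h k
    have hlt := s.lo_lt_hi k
    simp only [eq_iff_iff]
    by_cases hx : s.perm k x = x
    · rw [hx]
    · rcases (s.perm_ne_iff k x).1 hx with rfl | rfl
      · rw [s.perm_eq_swap, Equiv.swap_apply_left]; omega
      · rw [s.perm_eq_swap, Equiv.swap_apply_right]; omega

/-- The arcs realize `n` distinct sign vectors and there are at most `n`, so every region has the
sign vector of an arc. -/
theorem exists_arcMid_mem_cell (hn : 1 ≤ n) {s : TranspositionSeq n (n - 1)} (hs : s ∈ FDown n)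
    (C : CirclePoints n) {p : ℂ} (hp : p ∈ C.chordComplement s) :
    ∃ u, C.arcMid u ∈ C.cell s p := by
  classical
  have hcard := card_sideVecs_le hs C Finset.univ
  rw [Finset.card_univ, Fintype.card_fin, Nat.sub_add_cancel hn] at hcard
  set f : Fin n → (Fin (n - 1) → Bool) := fun u => C.sideVec s Finset.univ (C.arcMid u) with hf
  have hinj : Function.Injective f := fun u v huv => arc_eq_of_forall hs C fun k =>
    C.side_pos_iff_of_sideVec_eq s (Finset.mem_univ k) (congrFun huv k)
  have himage : Finset.univ.image f = C.sideVecs s Finset.univ := by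
    apply Finset.eq_of_subset_of_card_le
    · intro τ hτ
      obtain ⟨u, -, rfl⟩ := Finset.mem_image.1 hτ
      simp only [sideVecs, Finset.mem_filter, Finset.mem_univ, true_and]
      exact ⟨_, C.arcMid_mem_chordComplement s u, rfl⟩
    · rwa [Finset.card_image_of_injective _ hinj, Finset.card_univ, Fintype.card_fin]
  have hmem : C.sideVec s Finset.univ p ∈ Finset.univ.image f := by
    rw [himage]
    simp only [sideVecs, Finset.mem_filter, Finset.mem_univ, true_and]
    exact ⟨p, hp, rfl⟩
  obtain ⟨u, -, hu⟩ := Finset.mem_image.1 hmem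
  refine ⟨u, C.at_angle_mem_closedBall _, fun k => ?_⟩
  rw [← pos_iff_pos_iff_mul_pos (((C.mem_chordComplement_iff s p).1 hp).2 k)
    (C.side_arcMid_ne_zero s k u)]
  exact C.side_pos_iff_of_sideVec_eq s (Finset.mem_univ k) (congrFun hu k).symm

theorem regions_eq_range (hn : 1 ≤ n) {s : TranspositionSeq n (n - 1)} (hs : s ∈ FDown n)
    (C : CirclePoints n) : C.regions s = Set.range fun u => C.cell s (C.arcMid u) := by
  ext R
  constructor
  · rintro ⟨p, hp, rfl⟩
    obtain ⟨u, hu⟩ := exists_arcMid_mem_cell hn hs C hp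
    exact ⟨u, by simp only [C.connectedComponentIn_eq_cell s hp, C.cell_eq_of_mem s hu]⟩
  · rintro ⟨u, rfl⟩
    exact ((C.isRegionOf_iff s u _).2 rfl).1

theorem cell_arcMid_injective {s : TranspositionSeq n (n - 1)} (hs : s ∈ FDown n)
    (C : CirclePoints n) : Function.Injective fun u => C.cell s (C.arcMid u) := by
  intro u v huv
  have hmem : C.arcMid v ∈ C.cell s (C.arcMid u) := by
    have := C.mem_cell_self s (C.arcMid_mem_chordComplement s v)
    simp only at huv
    rwa [← huv] at this
  exact arc_eq_of_forall hs C fun k => (pos_iff_pos_iff_mul_pos (C.side_arcMid_ne_zero s k u)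
    (C.side_arcMid_ne_zero s k v)).2 (hmem.2 k)

/-! ### The chords on the boundary of a region -/

/-- Passing to the closure keeps weak signs, and these are strict at the midpoint of chord `k`.
Conversely, the open segment from the arc to any point of the chord stays in the cell. -/
theorem chord_subset_frontier_iff {s : TranspositionSeq n (n - 1)} (hs : s ∈ FDown n)
    (C : CirclePoints n) (u : Fin n) (k : Fin (n - 1)) :
    C.chord s k ⊆ frontier (C.cell s (C.arcMid u)) ↔
      ∀ j ≠ k, (0 < C.side s j (C.arcMid u) ↔ 0 < C.side s j (C.chordMid s k)) := by
  constructor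
  · intro h j hjk
    have hmem := frontier_subset_closure (h (C.chordMid_mem_chord s k))
    have hclosed : IsClosed {q | 0 ≤ C.side s j (C.arcMid u) * C.side s j q} :=
      isClosed_le continuous_const (continuous_const.mul (C.continuous_side s j))
    have hle : 0 ≤ C.side s j (C.arcMid u) * C.side s j (C.chordMid s k) :=
      closure_minimal (fun q hq => (hq.2 j).le) hclosed hmem
    have h1 := C.side_arcMid_ne_zero s j u
    have h2 := side_chordMid_ne_zero hs C hjk
    exact (pos_iff_pos_iff_mul_pos h1 h2).2 (lt_of_le_of_ne hle (mul_ne_zero h1 h2).symm)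
  · intro h q hq
    have hq0 := (C.mem_chord_iff s k q).1 hq
    have hu := C.mem_cell_self s (C.arcMid_mem_chordComplement s u)
    refine ⟨?_, fun hint => ?_⟩
    · have hsub : openSegment ℝ (C.arcMid u) q ⊆ C.cell s (C.arcMid u) := by
        intro z hz
        have hz1 : z ∈ Metric.closedBall C.center C.radius :=
          (convex_closedBall _ _).segment_subset hu.1 hq0.1 (openSegment_subset_segment ℝ _ _ hz)
        obtain ⟨t, v, ht, hv, htv, rfl⟩ := hz
        refine ⟨hz1, fun j => ?_⟩
        rw [C.side_combo s j htv]
        have h1 := mul_pos ht (hu.2 j)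
        have h2 : 0 ≤ C.side s j (C.arcMid u) * C.side s j q := by
          by_cases hjk : j = k
          · rw [hjk, hq0.2, mul_zero]
          · have h3 := side_mul_chordMid_nonneg hs C hjk hq
            have h4 := h j hjk
            rcases lt_or_gt_of_ne (side_chordMid_ne_zero hs C hjk) with h5 | h5
            · have h6 : C.side s j (C.arcMid u) ≤ 0 := not_lt.1 (h4.not.2 h5.not_gt)
              exact mul_nonneg_of_nonpos_of_nonpos h6 (nonpos_of_mul_nonneg_left h3 h5)
            · exact mul_nonneg (h4.2 h5).le (nonneg_of_mul_nonneg_left h3 h5)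
        have := mul_nonneg hv.le h2
        linarith
      apply closure_mono hsub
      rw [closure_openSegment]
      exact right_mem_segment ℝ _ _
    · have := (interior_subset hint).2 k
      rw [hq0.2, mul_zero] at this
      exact lt_irrefl 0 this

theorem side_pos_iff_of_migtUses {s : TranspositionSeq n (n - 1)} (hs : s ∈ FDown n)
    (C : CirclePoints n) {u : Fin n} {k : Fin (n - 1)} (hu : s.MigtUses u k) {j : Fin (n - 1)}
    (hjk : j ≠ k) : 0 < C.side s j (C.arcMid u) ↔ 0 < C.side s j (C.chordMid s k) := by
  obtain ⟨P, hP⟩ := TranspositionSeq.exists_isCut hs k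
  have hPj := hP.2 j hjk
  have hchange := hP.ne_of_migtUses hs hu
  have hpred := TranspositionSeq.finRotate_symm_val u
  have hjlt := s.lo_lt_hi j
  -- Both ends of `j` are on one side of the cut of `k`. An end `z` of `k` and a point `w` among `u
  -- - 1`, `u` are on the other side. If chord `j` separated arc `u` from chord `k`, it would
  -- separate `w` from `z`, and the cut would alternate.
  obtain ⟨z, hz, hzP⟩ : ∃ z, (z = s.lo k ∨ z = s.hi k) ∧ P z ≠ P (s.lo j) := by
    by_cases h : P (s.lo k) = P (s.lo j)
    · exact ⟨_, Or.inr rfl, fun h' => hP.1 (h.trans h'.symm)⟩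
    · exact ⟨_, Or.inl rfl, h⟩
  obtain ⟨w, hw, hwP⟩ : ∃ w, (w = (finRotate n).symm u ∨ w = u) ∧ P w ≠ P (s.lo j) := by
    by_cases h : P ((finRotate n).symm u) = P (s.lo j)
    · exact ⟨_, Or.inr rfl, fun h' => hchange (h.trans h'.symm)⟩
    · exact ⟨_, Or.inl rfl, h⟩
  have hz1 : z ≠ s.lo j := by rintro rfl; exact hzP rfl
  have hz2 : z ≠ s.hi j := by rintro rfl; exact hzP hPj.symm
  have hw1 : w ≠ s.lo j := by rintro rfl; exact hwP rfl
  have hw2 : w ≠ s.hi j := by rintro rfl; exact hwP hPj.symm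
  have hklt := s.lo_lt_hi k
  have hwv : (w : ℕ) = u ∨ (w : ℕ) = if (u : ℕ) = 0 then n - 1 else u - 1 := by
    rcases hw with rfl | rfl
    · exact Or.inr hpred
    · exact Or.inl rfl
  rw [side_arcMid_pos_iff]
  rcases side_ends hs C hjk with ⟨-, -, h3, h4, h5⟩ | ⟨-, -, h3, h4, h5⟩
  · refine iff_of_true ?_ h3
    by_contra hc
    refine hP.not_separated hs (a := s.lo j) (z := z) (b := s.hi j) (w := w) ?_ ?_ ?_ hPj hzP hwP
    · omega
    · omega
    · split_ifs at hwv <;> omega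
  · refine iff_of_false ?_ h3.not_gt
    intro hc
    refine hP.not_separated hs (a := s.lo j) (z := w) (b := s.hi j) (w := z) ?_ ?_ ?_ hPj hwP hzP
    · split_ifs at hwv <;> omega
    · split_ifs at hwv <;> omega
    · omega

theorem migtUses_iff_chord_subset_frontier {s : TranspositionSeq n (n - 1)} (hs : s ∈ FDown n)
    (C : CirclePoints n) (u : Fin n) (k : Fin (n - 1)) :
    s.MigtUses u k ↔ C.chord s k ⊆ frontier (C.cell s (C.arcMid u)) := by
  rw [chord_subset_frontier_iff hs]
  refine ⟨fun hu j hjk => side_pos_iff_of_migtUses hs C hu hjk, fun h => ?_⟩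
  set v := (s.partialProd k)⁻¹ (s.lo k) with hv
  set w := (s.partialProd k)⁻¹ (s.hi k) with hw
  have hvk : s.MigtUses v k := (s.migtUses_iff_eq_or_eq v k).2 (Or.inl rfl)
  have hwk : s.MigtUses w k := (s.migtUses_iff_eq_or_eq w k).2 (Or.inr rfl)
  have hvw : v ≠ w := fun h => (s.lo_lt_hi k).ne ((s.partialProd k)⁻¹.injective h)
  have heq : ∀ {x y : Fin n},
      (∀ j ≠ k, (0 < C.side s j (C.arcMid x) ↔ 0 < C.side s j (C.chordMid s k))) →
      (∀ j ≠ k, (0 < C.side s j (C.arcMid y) ↔ 0 < C.side s j (C.chordMid s k))) →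
      (0 < C.side s k (C.arcMid x) ↔ 0 < C.side s k (C.arcMid y)) → x = y := by
    intro x y hx hy hxy
    refine arc_eq_of_forall hs C fun j => ?_
    by_cases hjk : j = k
    · rw [hjk]; exact hxy
    · exact (hx j hjk).trans (hy j hjk).symm
  have hv' : ∀ j ≠ k, _ := fun j hjk => side_pos_iff_of_migtUses hs C hvk hjk
  have hw' : ∀ j ≠ k, _ := fun j hjk => side_pos_iff_of_migtUses hs C hwk hjk
  -- The arcs `v` and `w` are thus on opposite sides of chord `k`, so arc `u` agrees with one of
  -- them there, hence everywhere.
  have hne := fun h => hvw (heq hv' hw' h)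
  by_cases huv : 0 < C.side s k (C.arcMid u) ↔ 0 < C.side s k (C.arcMid v)
  · rw [heq h hv' huv]; exact hvk
  · rw [heq h hw' (by tauto)]; exact hwk

/-! ### Equality of the duals and the main theorem. -/

theorem gouldenYongDual_eq_trailDual {s : TranspositionSeq n (n - 1)} (hs : s ∈ FDown n)
    (C : CirclePoints n) : C.gouldenYongDual s = s.trailDual := by
  funext k
  ext e
  simp only [gouldenYongDual, TranspositionSeq.trailDual, isRegionOf_iff, Set.mem_ofPred_eq,
    migtUses_iff_chord_subset_frontier hs C]
  constructor
  · rintro ⟨u, v, _, _, rfl, rfl, hne, hu, hv, rfl⟩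
    exact ⟨u, v, fun h => hne (by rw [h]), hu, hv, rfl⟩
  · rintro ⟨u, v, hne, hu, hv, rfl⟩
    exact ⟨u, v, _, _, rfl, rfl, fun h => hne (cell_arcMid_injective hs C h), hu, hv, rfl⟩

end CirclePoints

theorem mainTheorem3 {n : ℕ} (hn : 1 ≤ n) (s : TranspositionSeq n (n - 1)) (hs : s ∈ FDown n)
    (C : CirclePoints n) :
    C.NonCrossing s ∧
    (C.regions s).ncard = n ∧
    (∀ k : Fin n, ∃! R, C.IsRegionOf s k R) ∧
    (∀ R ∈ C.regions s, ∃! k : Fin n, C.IsRegionOf s k R) ∧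
    C.gouldenYongDual s = s.trailDual ∧
    C.gouldenYongDual s = s.mindBodyDual.graph ∧
    (∀ (x : Fin n) (R : Set ℂ), C.IsRegionOf s x R →
      ∀ k : Fin (n - 1), s.MigtUses x k ↔ C.chord s k ⊆ frontier R) := by
  have hinj := CirclePoints.cell_arcMid_injective hs C
  have hdual := CirclePoints.gouldenYongDual_eq_trailDual hs C
  refine ⟨CirclePoints.nonCrossing hs C, ?_, ?_, ?_, hdual,
    hdual.trans s.trailDual_eq_mindBodyDual_graph, ?_⟩
  · rw [CirclePoints.regions_eq_range hn hs, ← Set.image_univ, Set.ncard_image_of_injective _ hinj,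
      Set.ncard_univ, Nat.card_fin]
  · intro k
    simp only [CirclePoints.isRegionOf_iff]
    exact existsUnique_eq
  · rw [CirclePoints.regions_eq_range hn hs]
    rintro _ ⟨u, rfl⟩
    simp only [CirclePoints.isRegionOf_iff]
    exact ⟨u, rfl, fun v hv => (hinj hv).symm⟩
  · intro x R hR k
    rw [(C.isRegionOf_iff s x R).1 hR]
    exact CirclePoints.migtUses_iff_chord_subset_frontier hs C x k
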